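/- Let $\mu,\rho\in\mathbb{C}$ with $\mathrm{Re}(\mu)>0$, $\mathrm{Re}(\rho)>0$ and $\rho\notin\mathbb{Z}^+$. Then for every complex $z\neq 1$ with $|1-z|<1$ and $|\arg(1-z)|<\pi$, the series below converges absolutely and $$ {}_2F_1(\mu,\rho;\mu+\rho;z)= -\frac{\Gamma(\mu+\rho)}{\Gamma(\rho)\Gamma(\mu)}\,{}_2F_1(\mu,\rho;1;1-z)\,\log(1-z) +\frac{\Gamma(\mu+\rho)}{\Gamma(\rho)\Gamma(\mu)}\sum_{k=0}^{\infty}\frac{(\mu)_k(\rho)_k}{(k!)^2}\bigl[2\psi(k+1)-\psi(k+\mu)-\psi(k+\rho)\bigr](1-z)^k . $$ Here $\log$ is the principal logarithm, $\psi=\Gamma'/\Gamma$ is the digamma function, $(x)_k=x(x+1)\cdots(x+k-1)$ is the Pochhammer symbol, and ${}_2F_1(a,b;c;w)$ is the Gauss hypergeometric function: the sum of $\sum_{k\ge 0}\frac{(a)_k(b)_k}{(c)_k}\frac{w^k}{k!}$ for $|w|<1$, and for other $w\in\mathbb{C}\setminus[1,\infty)$ the value of its analytic continuation to $\mathbb{C}\setminus[1,\infty)$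 (in particular, this continuation of ${}_2F_1(\mu,\rho;\mu+\rho;\cdot)$ exists). -/

import Mathlib

/-- The plane cut along the half-line `[1, ∞)`. -/
def gaussDomain : Set ℂ := {z : ℂ | 1 - z ∈ Complex.slitPlane}

/-- `F` is the principal branch of the Gauss function with parameters `a, b; c`: it is holomorphic
on the plane cut along `[1, ∞)`, and on the open unit disc it is the sum of the Gauss series.
These two properties determine `F` on the (connected) cut plane. -/
def IsGaussBranch (a b c : ℂ) (F : ℂ → ℂ) : Prop :=
  DifferentiableOn ℂ F gaussDomain ∧ ∀ z : ℂ, ‖z‖ < 1 → F z = ₂F₁ a b c z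

open Classical in
/-- The Gauss hypergeometric function: the sum of the Gauss series on the open unit disc, and its
analytic continuation (principal branch) on the rest of the plane cut along `[1, ∞)`. Its values on
the cut itself carry no meaning. -/
noncomputable def gaussF (a b c z : ℂ) : ℂ :=
  if ‖z‖ < 1 then ₂F₁ a b c z
  else if h : ∃ F : ℂ → ℂ, IsGaussBranch a b c F then h.choose z
  else 0

section

open Filter Topology Set MeasureTheory Interval

/-! Write `a`, `b` for the parameters, `x = 1 - z`, `w` for the Gauss series with `c = 1`, and `g`
for the power series with coefficients `logCoeff a b`. Euler's integral `eulerIntegral a b` is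
holomorphic on the cut plane and equals `Γ(a)Γ(b)/Γ(a+b)` times the Gauss series on the disc
(`isGaussBranch_eulerIntegral`), so it supplies the continuation, and the claim becomes `E(1 - x) =
-w(x) log x + g(x)`.

On the lens where `|x| < 1` and `|1 - x| < 1`, both sides solve the hypergeometric equation with `c
= 1` (`gaussODE_reflected`, `gaussODE_logarithmic`). That equation has one regular solution at `0`
and one with a logarithm, so a solution tending to `0` there must vanish; the Wronskian with `w`
proves this (`gaussODE_eventually_eq_zero`). What remains is the constant term at the singularity:
`E(1 - x) + log x → 2ψ(1) - ψ(a) - ψ(b)` (`tendsto_eulerIntegral_add_log`), which rests on Gauss'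
integral for `ψ`. The identity theorem carries the formula from the lens to the slit disc
(`eulerIntegral_eq`). -/

/-! ### Power series on the open unit disc -/

/-- The power series with coefficients `a` converges absolutely on the open unit disc. -/
def SummableOnDisc (a : ℕ → ℂ) : Prop :=
  ∀ r : ℝ, 0 < r → r < 1 → Summable fun k : ℕ => ‖a k‖ * r ^ k

/-- The sum of the power series with coefficients `a`. -/
noncomputable def seriesSum (a : ℕ → ℂ) (z : ℂ) : ℂ := ∑' k : ℕ, a k * z ^ k

/-- The coefficients of the derivative of a power series. -/
def derivCoeff (a : ℕ → ℂ) (k : ℕ) : ℂ := (k + 1) * a (k + 1)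

namespace SummableOnDisc

variable {a b : ℕ → ℂ}

theorem of_norm_le (hb : SummableOnDisc b) (h : ∀ k, ‖a k‖ ≤ ‖b k‖) : SummableOnDisc a :=
  fun r h0 h1 => (hb r h0 h1).of_nonneg_of_le (fun k => by positivity)
    fun k => mul_le_mul_of_nonneg_right (h k) (by positivity)

theorem const_mul (ha : SummableOnDisc a) (c : ℂ) : SummableOnDisc fun k => c * a k :=
  fun r h0 h1 => by simpa [mul_assoc] using (ha r h0 h1).mul_left ‖c‖

/-- Pass to a radius `s` with `r < s < 1`: the terms at radius `s` are bounded, and `(k + 1) (r / s)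
^ k` is summable. -/
theorem add_one_mul (ha : SummableOnDisc a) : SummableOnDisc fun k => ((k : ℂ) + 1) * a k := by
  intro r h0 h1
  obtain ⟨s, hrs, hs1⟩ := exists_between h1
  have hs0 : 0 < s := h0.trans hrs
  have hq : ‖r / s‖ < 1 := by
    rw [Real.norm_of_nonneg (by positivity)]; exact (div_lt_one hs0).2 hrs
  have hsum : Summable fun k : ℕ => ((k : ℝ) + 1) * (r / s) ^ k := by
    have h := (summable_pow_mul_geometric_of_norm_lt_one 1 hq).add
      (summable_geometric_of_norm_lt_one hq)
    refine h.congr fun k => ?_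
    ring
  have hbd : ∃ M : ℝ, ∀ k, ‖a k‖ * s ^ k ≤ M :=
    ⟨∑' k, ‖a k‖ * s ^ k, fun k => (ha s hs0 hs1).le_tsum k fun j _ => by positivity⟩
  obtain ⟨M, hM⟩ := hbd
  refine (hsum.mul_left M).of_nonneg_of_le (fun k => by positivity) fun k => ?_
  have hk : ‖((k : ℂ) + 1)‖ = (k : ℝ) + 1 := by
    rw [← Nat.cast_add_one, Complex.norm_natCast]; push_cast; ring
  rw [norm_mul, hk]
  have : ((k : ℝ) + 1) * ‖a k‖ * r ^ k = (‖a k‖ * s ^ k) * (((k : ℝ) + 1) * (r / s) ^ k) := by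
    rw [div_pow]; field_simp
  rw [this]
  exact mul_le_mul_of_nonneg_right (hM k) (by positivity)

theorem derivCoeff (ha : SummableOnDisc a) : SummableOnDisc (derivCoeff a) := by
  have h : SummableOnDisc fun k => (k : ℂ) * a k := ha.add_one_mul.of_norm_le fun k => by
    rw [norm_mul, norm_mul]
    refine mul_le_mul_of_nonneg_right ?_ (norm_nonneg _)
    rw [← Nat.cast_add_one, Complex.norm_natCast, Complex.norm_natCast]; push_cast; linarith
  intro r h0 h1
  have := (summable_nat_add_iff 1).2 (h r h0 h1)
  refine (this.mul_left r⁻¹).congr fun k => ?_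
  rw [_root_.derivCoeff]
  push_cast
  field_simp
  ring

theorem summable_norm (ha : SummableOnDisc a) {z : ℂ} (hz : ‖z‖ < 1) :
    Summable fun k : ℕ => ‖a k * z ^ k‖ := by
  obtain ⟨r, hr, hr1⟩ := exists_between hz
  refine (ha r ((norm_nonneg _).trans_lt hr) hr1).of_nonneg_of_le (fun k => norm_nonneg _)
    fun k => ?_
  rw [norm_mul, norm_pow]
  gcongr

theorem hasSum (ha : SummableOnDisc a) {z : ℂ} (hz : ‖z‖ < 1) :
    HasSum (fun k : ℕ => a k * z ^ k) (seriesSum a z) :=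
  (ha.summable_norm hz).of_norm.hasSum

theorem hasDerivAt (ha : SummableOnDisc a) {z : ℂ} (hz : ‖z‖ < 1) :
    HasDerivAt (seriesSum a) (seriesSum (_root_.derivCoeff a) z) z := by
  obtain ⟨r, hr, hr1⟩ := exists_between hz
  have hr0 := (norm_nonneg _).trans_lt hr
  have hzr : z ∈ Metric.ball (0 : ℂ) r := by simpa using hr
  have hf : ∀ k : ℕ, DifferentiableOn ℂ (fun w : ℂ => a k * w ^ k) (Metric.ball 0 r) :=
    fun k => by fun_prop
  have hle : ∀ (k : ℕ) (w : ℂ), w ∈ Metric.ball (0 : ℂ) r → ‖a k * w ^ k‖ ≤ ‖a k‖ * r ^ k := by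
    intro k w hw
    rw [norm_mul, norm_pow]
    have : ‖w‖ ≤ r := by simpa using (mem_ball_zero_iff.1 hw).le
    gcongr
  have hd := (Complex.differentiableOn_tsum_of_summable_norm (ha r hr0 hr1) hf
    Metric.isOpen_ball hle).differentiableAt (Metric.isOpen_ball.mem_nhds hzr)
  have hs := Complex.hasSum_deriv_of_summable_norm (ha r hr0 hr1) hf Metric.isOpen_ball hle hzr
  have hs' : HasSum (fun k : ℕ => _root_.derivCoeff a k * z ^ k)
      (deriv (fun w : ℂ => ∑' k : ℕ, a k * w ^ k) z) := by
    have := (hasSum_nat_add_iff' 1).2 hs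
    simp only [Finset.range_one, Finset.sum_singleton, pow_zero, mul_one, deriv_const,
      sub_zero] at this
    refine this.congr_fun fun k => ?_
    simp [_root_.derivCoeff]
    ring
  have := hd.hasDerivAt
  rwa [(hs'.unique (ha.derivCoeff.hasSum hz))] at this

theorem hasSum_index_mul (ha : SummableOnDisc a) {z : ℂ} (hz : ‖z‖ < 1) :
    HasSum (fun k : ℕ => (k : ℂ) * a k * z ^ k) (z * seriesSum (_root_.derivCoeff a) z) := by
  refine (hasSum_nat_add_iff' 1).1 ?_
  simp only [Finset.range_one, Finset.sum_singleton, Nat.cast_zero, zero_mul, sub_zero]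
  refine ((ha.derivCoeff.hasSum hz).mul_left z).congr_fun fun k => ?_
  simp only [_root_.derivCoeff]
  push_cast
  ring

/-- The hypergeometric differential equation, read off from the recurrence of the coefficients. -/
theorem hypergeometric_ode (ha : SummableOnDisc a) {α β c z s : ℂ} (hz : ‖z‖ < 1) {e : ℕ → ℂ}
    (hrec : ∀ k : ℕ, ((k : ℂ) + 1) * (k + c) * a (k + 1) - (k + α) * (k + β) * a k = e k)
    (he : HasSum (fun k => e k * z ^ k) s) :
    z * (1 - z) * seriesSum (_root_.derivCoeff (_root_.derivCoeff a)) z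
      + (c - (α + β + 1) * z) * seriesSum (_root_.derivCoeff a) z
      - α * β * seriesSum a z = s := by
  have h0 := ha.hasSum hz
  have h1 := ha.derivCoeff.hasSum hz
  have h1' := ha.hasSum_index_mul hz
  have h2 := ha.derivCoeff.hasSum_index_mul hz
  have h2' : HasSum (fun k : ℕ => (k : ℂ) * (k - 1) * a k * z ^ k)
      (z * (z * seriesSum (_root_.derivCoeff (_root_.derivCoeff a)) z)) := by
    refine (hasSum_nat_add_iff' 1).1 ?_
    simp only [Finset.range_one, Finset.sum_singleton, Nat.cast_zero, zero_mul, sub_zero]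
    refine (h2.mul_left z).congr_fun fun k => ?_
    simp only [_root_.derivCoeff]
    push_cast
    ring
  have h := (((h2.sub h2').add (h1.mul_left c)).sub (h1'.mul_left (α + β + 1))).sub
    (h0.mul_left (α * β))
  have h' := he.unique (h.congr_fun fun k => by
    rw [← hrec k]
    simp only [_root_.derivCoeff]
    ring)
  rw [h']
  ring

end SummableOnDisc

/-! ### Uniqueness at the singular point -/

/-- The lens on which both `x` and `1 - x` lie in the unit disc. -/
def lens : Set ℂ := Metric.ball 0 1 ∩ Metric.ball 1 1

theorem isOpen_lens : IsOpen lens := Metric.isOpen_ball.inter Metric.isOpen_ball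

theorem convex_lens : Convex ℝ lens := (convex_ball _ _).inter (convex_ball _ _)

theorem mem_lens {x : ℂ} : x ∈ lens ↔ ‖x‖ < 1 ∧ ‖1 - x‖ < 1 := by
  rw [lens, mem_inter_iff, mem_ball_zero_iff, mem_ball_iff_norm, norm_sub_rev]

theorem re_pos_of_mem_lens {x : ℂ} (hx : x ∈ lens) : 0 < x.re := by
  have h := (Complex.re_le_norm (1 - x)).trans_lt (mem_lens.1 hx).2
  simp at h
  exact h

theorem mem_slitPlane_of_mem_lens {x : ℂ} (hx : x ∈ lens) : x ∈ Complex.slitPlane :=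
  Or.inl (re_pos_of_mem_lens hx)

theorem one_sub_mem_slitPlane_of_norm_lt_one {x : ℂ} (hx : ‖x‖ < 1) :
    1 - x ∈ Complex.slitPlane := by
  left
  have h := (Complex.re_le_norm x).trans_lt hx
  simpa using h

/-- `w` and its derivatives `w₁`, `w₂` solve the hypergeometric equation with `c = 1` at `x`. -/
structure GaussODE (a b : ℂ) (w w₁ w₂ : ℂ → ℂ) (x : ℂ) : Prop where
  hasDerivAt : HasDerivAt w (w₁ x) x
  hasDerivAt_deriv : HasDerivAt w₁ (w₂ x) x
  ode : x * (1 - x) * w₂ x + (1 - (a + b + 1) * x) * w₁ x - a * b * w x = 0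

/-- If `f` tends to zero at `0` within the lens, so does `r * f' r` along the positive reals, by
Cauchy's estimate on the discs `ball r (r / 2)`. -/
theorem tendsto_ofReal_mul_deriv_zero {f f₁ : ℂ → ℂ} (hf : ∀ x ∈ lens, HasDerivAt f (f₁ x) x)
    (h0 : Tendsto f (𝓝[lens] 0) (𝓝 0)) :
    Tendsto (fun r : ℝ => (r : ℂ) * f₁ r) (𝓝[>] 0) (𝓝 0) := by
  rw [Metric.tendsto_nhds]
  intro ε hε
  -- Cauchy's estimate at radius `r / 2` doubles the bound: `r * (ε / 4) / (r / 2) = ε / 2`.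
  have h := (Metric.tendsto_nhds.1 h0) (ε / 4) (by positivity)
  obtain ⟨δ, hδ, hδ'⟩ := Metric.mem_nhdsWithin_iff.1 h
  have hmem : Ioo (0 : ℝ) (min (δ / 2) (1 / 2)) ∈ 𝓝[>] (0 : ℝ) :=
    Ioo_mem_nhdsGT (by positivity)
  filter_upwards [hmem] with r hr
  have hr0 := hr.1
  have hr1 := hr.2.trans_le (min_le_left _ _)
  have hr2 := hr.2.trans_le (min_le_right _ _)
  have hball : Metric.closedBall (r : ℂ) (r / 2) ⊆ lens ∩ Metric.ball 0 δ := by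
    intro y hy
    rw [mem_closedBall_iff_norm] at hy
    have h1 : ‖y‖ ≤ 3 / 2 * r := by
      have := norm_add_le (y - r) (r : ℂ)
      rw [sub_add_cancel, Complex.norm_real, Real.norm_of_nonneg hr0.le] at this
      linarith
    have h2 : ‖1 - y‖ ≤ 1 - r / 2 := by
      have := norm_sub_le (1 - (r : ℂ)) (y - r)
      rw [sub_sub_sub_cancel_right, ← Complex.ofReal_one, ← Complex.ofReal_sub,
        Complex.norm_real, Real.norm_of_nonneg (by linarith)] at this
      push_cast at this
      linarith
    exact ⟨mem_lens.2 ⟨by linarith, by linarith⟩, by rw [mem_ball_zero_iff]; linarith⟩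
  have hd : DiffContOnCl ℂ f (Metric.ball (r : ℂ) (r / 2)) := by
    refine DifferentiableOn.diffContOnCl fun y hy => ?_
    have hy' := Metric.closure_ball_subset_closedBall hy
    exact (hf y (hball hy').1).differentiableAt.differentiableWithinAt
  have hle := Complex.norm_deriv_le_of_forall_mem_sphere_norm_le (by positivity) hd
    (C := ε / 4) (fun y hy => by
      have hy' := hball (Metric.sphere_subset_closedBall hy)
      have := hδ' ⟨hy'.2, hy'.1⟩
      simp only [mem_ofPred_eq, dist_zero_right] at this
      exact this.le)
  have hrl : (r : ℂ) ∈ lens := (hball (Metric.mem_closedBall_self (by positivity))).1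
  rw [(hf r hrl).deriv] at hle
  rw [dist_zero_right, norm_mul, Complex.norm_real, Real.norm_of_nonneg hr0.le]
  calc r * ‖f₁ r‖ ≤ r * (ε / 4 / (r / 2)) := by gcongr
    _ = ε / 2 := by field_simp; ring
    _ < ε := by linarith

theorem tendsto_ofReal_nhdsWithin_lens :
    Tendsto (fun r : ℝ => (r : ℂ)) (𝓝[>] 0) (𝓝[lens] 0) := by
  refine tendsto_nhdsWithin_iff.2 ⟨?_, ?_⟩
  · have := (Complex.continuous_ofReal.tendsto 0).mono_left (nhdsWithin_le_nhds (s := Ioi (0 : ℝ)))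
    simpa using this
  · filter_upwards [Ioo_mem_nhdsGT (zero_lt_one (α := ℝ))] with r hr
    rw [mem_lens, ← Complex.ofReal_one, ← Complex.ofReal_sub, Complex.norm_real, Complex.norm_real,
      Real.norm_of_nonneg hr.1.le, Real.norm_of_nonneg (by linarith [hr.2])]
    exact ⟨hr.2, by linarith [hr.1]⟩

theorem neBot_nhdsWithin_lens : (𝓝[lens] (0 : ℂ)).NeBot :=
  tendsto_ofReal_nhdsWithin_lens.neBot

theorem eq_of_hasDerivAt_zero {f : ℂ → ℂ} {s : Set ℂ} (hs : IsOpen s) (hc : Convex ℝ s)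
    (hf : ∀ x ∈ s, HasDerivAt f 0 x) {x y : ℂ} (hx : x ∈ s) (hy : y ∈ s) : f x = f y :=
  hs.is_const_of_deriv_eq_zero hc.isPreconnected
    (fun x hx => (hf x hx).differentiableAt.differentiableWithinAt)
    (fun x hx => (hf x hx).deriv) hx hy

/-- A solution on the lens that tends to `0` at the singular point `0` vanishes near `0`: compare
its Wronskian with a solution that is regular and nonzero at `0`. -/
theorem gaussODE_eventually_eq_zero {a b : ℂ} {w w₁ w₂ f f₁ f₂ : ℂ → ℂ}
    (hw : ∀ x ∈ lens, GaussODE a b w w₁ w₂ x) (hf : ∀ x ∈ lens, GaussODE a b f f₁ f₂ x)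
    (hw0 : w 0 ≠ 0) (hwc : ContinuousAt w 0) (hw₁c : ContinuousAt w₁ 0)
    (hf0 : Tendsto f (𝓝[lens] 0) (𝓝 0)) : ∀ᶠ x in 𝓝[lens] 0, f x = 0 := by
  -- Abel's formula: the ratio of the first two coefficients of the equation is `1 / x - (a + b) /
  -- (1 - x)`, whose integrating factor `x (1 - x) ^ (a + b)` makes the weighted Wronskian constant.
  set V : ℂ → ℂ := fun x => x * (1 - x) ^ (a + b) * (w x * f₁ x - f x * w₁ x) with hV
  have hVd : ∀ x ∈ lens, HasDerivAt V 0 x := by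
    intro x hx
    have hx1 : 1 - x ∈ Complex.slitPlane := one_sub_mem_slitPlane_of_norm_lt_one (mem_lens.1 hx).1
    have hne : 1 - x ≠ 0 := Complex.slitPlane_ne_zero hx1
    have hx0 : x ≠ 0 := Complex.slitPlane_ne_zero (mem_slitPlane_of_mem_lens hx)
    have hp : HasDerivAt (fun x : ℂ => (1 - x) ^ (a + b))
        ((a + b) * (1 - x) ^ (a + b - 1) * (-1)) x :=
      ((hasDerivAt_id x).const_sub 1).cpow_const hx1
    have hW := ((hw x hx).hasDerivAt.mul (hf x hx).hasDerivAt_deriv).sub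
      ((hf x hx).hasDerivAt.mul (hw x hx).hasDerivAt_deriv)
    have h := ((hasDerivAt_id x).mul hp).mul hW
    convert! h using 1
    simp only [id, Pi.mul_apply, Pi.sub_apply]
    rw [Complex.cpow_sub _ _ hne, Complex.cpow_one]
    have e1 := (hw x hx).ode
    have e2 := (hf x hx).ode
    field_simp
    linear_combination (-(1 - x) ^ (a + b) * w x) * e2 + ((1 - x) ^ (a + b) * f x) * e1
  have hVt : Tendsto (fun r : ℝ => V r) (𝓝[>] 0) (𝓝 0) := by
    have hr0 : Tendsto (fun r : ℝ => (r : ℂ)) (𝓝[>] 0) (𝓝 0) :=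
      tendsto_ofReal_nhdsWithin_lens.mono_right nhdsWithin_le_nhds
    have h1 : Tendsto (fun r : ℝ => (1 - (r : ℂ)) ^ (a + b)) (𝓝[>] 0) (𝓝 ((1 - 0) ^ (a + b))) := by
      have : ContinuousAt (fun x : ℂ => (1 - x) ^ (a + b)) 0 :=
        (continuousAt_const.sub continuousAt_id).cpow continuousAt_const (by simp)
      exact this.tendsto.comp hr0
    have h2 := tendsto_ofReal_mul_deriv_zero (fun x hx => (hf x hx).hasDerivAt) hf0
    have h3 := hf0.comp tendsto_ofReal_nhdsWithin_lens
    have h4 := hwc.tendsto.comp hr0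
    have h5 := hw₁c.tendsto.comp hr0
    have h := h1.mul ((h4.mul h2).sub ((hr0.mul h3).mul h5))
    simp only [mul_zero, zero_mul, sub_zero] at h
    refine h.congr fun r => ?_
    simp only [hV, Function.comp]
    ring
  have hV0 : ∀ x ∈ lens, V x = 0 := by
    intro x hx
    refine tendsto_nhds_unique (tendsto_const_nhds.congr' ?_) hVt
    filter_upwards [tendsto_ofReal_nhdsWithin_lens self_mem_nhdsWithin] with r hr
    exact eq_of_hasDerivAt_zero isOpen_lens convex_lens hVd hx hr
  obtain ⟨ε, hε, hwε⟩ := Metric.mem_nhds_iff.1 (hwc.eventually_ne hw0)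
  -- Where `w ≠ 0`, the derivative of `f / w` is the Wronskian over `w ^ 2`, hence zero; so `f / w`
  -- is a constant, and its limit at `0` is `0`.
  have hQd : ∀ x ∈ lens ∩ Metric.ball 0 ε, HasDerivAt (fun x => f x / w x) 0 x := by
    rintro x ⟨hx, hxε⟩
    have hwx : w x ≠ 0 := hwε hxε
    convert! (hf x hx).hasDerivAt.div (hw x hx).hasDerivAt hwx using 1
    have hx1 := Complex.slitPlane_ne_zero
      (one_sub_mem_slitPlane_of_norm_lt_one (mem_lens.1 hx).1)
    have hx0 := Complex.slitPlane_ne_zero (mem_slitPlane_of_mem_lens hx)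
    have h := hV0 x hx
    simp only [hV, mul_eq_zero, hx0, Complex.cpow_eq_zero_iff, hx1, false_or, false_and] at h
    rw [eq_comm, div_eq_zero_iff]
    left
    linear_combination h
  have hmem : lens ∩ Metric.ball 0 ε ∈ 𝓝[lens] (0 : ℂ) :=
    inter_mem self_mem_nhdsWithin (mem_nhdsWithin_of_mem_nhds (Metric.ball_mem_nhds _ hε))
  have hQ0 : Tendsto (fun x => f x / w x) (𝓝[lens] 0) (𝓝 0) := by
    have h := hf0.div (hwc.tendsto.mono_left nhdsWithin_le_nhds) hw0
    rwa [zero_div] at h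
  have := neBot_nhdsWithin_lens
  filter_upwards [hmem] with x hx
  have : f x / w x = 0 := by
    refine tendsto_nhds_unique (tendsto_const_nhds.congr' ?_) hQ0
    filter_upwards [hmem] with y hy
    exact eq_of_hasDerivAt_zero (isOpen_lens.inter Metric.isOpen_ball)
      (convex_lens.inter (convex_ball _ _)) hQd hx hy
  exact (div_eq_zero_iff.1 this).resolve_right (hwε hx.2)

/-! ### Coefficients of the Gauss series -/

theorem summableOnDisc_of_one_le_radius {a : ℕ → ℂ}
    (h : 1 ≤ (FormalMultilinearSeries.ofScalars ℂ a).radius) : SummableOnDisc a := by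
  intro r h0 h1
  lift r to NNReal using h0.le
  have hr : (r : ENNReal) < (FormalMultilinearSeries.ofScalars ℂ a).radius :=
    lt_of_lt_of_le (by exact_mod_cast h1) h
  simpa [FormalMultilinearSeries.ofScalars_norm] using
    (FormalMultilinearSeries.ofScalars ℂ a).summable_norm_mul_pow hr

theorem ne_neg_natCast_of_re_pos {a : ℂ} (ha : 0 < a.re) (k : ℕ) : (k : ℂ) ≠ -a := by
  intro h
  have := congrArg Complex.re h
  simp at this
  have hk : (0 : ℝ) ≤ k := k.cast_nonneg
  linarith

theorem summableOnDisc_gaussCoeff {a b c : ℂ} (ha : 0 < a.re) (hb : 0 < b.re) (hc : 0 < c.re) :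
    SummableOnDisc (ordinaryHypergeometricCoefficient a b c) :=
  summableOnDisc_of_one_le_radius (ordinaryHypergeometricSeries_radius_eq_one ℂ a b c fun k =>
    ⟨ne_neg_natCast_of_re_pos ha k, ne_neg_natCast_of_re_pos hb k,
      ne_neg_natCast_of_re_pos hc k⟩).ge

theorem gauss_eq_seriesSum (a b c z : ℂ) :
    ₂F₁ a b c z = seriesSum (ordinaryHypergeometricCoefficient a b c) z := by
  rw [ordinaryHypergeometric_eq_tsum, seriesSum]
  simp only [smul_eq_mul]

theorem gaussCoeff_succ {a b c : ℂ} (hc : 0 < c.re) (k : ℕ) :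
    ((k : ℂ) + 1) * (k + c) * ordinaryHypergeometricCoefficient a b c (k + 1) =
      (k + a) * (k + b) * ordinaryHypergeometricCoefficient a b c k := by
  have h1 : (k : ℂ) + c ≠ 0 := fun h => ne_neg_natCast_of_re_pos hc k (eq_neg_of_add_eq_zero_left h)
  have h2 : (k : ℂ) + 1 ≠ 0 := by exact_mod_cast k.succ_ne_zero
  simp only [ordinaryHypergeometricCoefficient, ascPochhammer_succ_eval, Nat.factorial_succ]
  push_cast
  rw [add_comm c (k : ℂ), mul_inv, mul_inv]
  field_simp
  ring

/-! ### Euler's integral and the analytic continuation -/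

/-- Euler's integral for the Gauss function with parameters `a, b; a + b`, without its prefactor. -/
noncomputable def eulerIntegral (a b z : ℂ) : ℂ :=
  ∫ t in (0 : ℝ)..1, (t : ℂ) ^ (b - 1) * (1 - (t : ℂ)) ^ (a - 1) * (1 - z * t) ^ (-a)

theorem choose_add_sub_one_eq (a : ℂ) (k : ℕ) :
    Ring.choose (a + k - 1) k = (ascPochhammer ℂ k).eval a / (k.factorial : ℂ) := by
  have hk : (k.factorial : ℂ) ≠ 0 := by exact_mod_cast k.factorial_ne_zero
  rw [← Ring.multichoose_eq, eq_div_iff hk, mul_comm, ← nsmul_eq_mul,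
    Ring.factorial_nsmul_multichoose_eq_ascPochhammer, Polynomial.ascPochhammer_smeval_eq_eval]

theorem binomial_summableOnDisc (a : ℂ) :
    SummableOnDisc fun k => (ascPochhammer ℂ k).eval a / (k.factorial : ℂ) := by
  have h : SummableOnDisc fun k => Ring.choose (a + k - 1) k :=
    summableOnDisc_of_one_le_radius
      (Complex.one_div_one_sub_cpow_hasFPowerSeriesOnBall_zero a).r_le
  simpa only [choose_add_sub_one_eq] using h

theorem hasSum_one_sub_cpow_neg (a : ℂ) {w : ℂ} (hw : ‖w‖ < 1) :
    HasSum (fun k : ℕ => (ascPochhammer ℂ k).eval a / (k.factorial : ℂ) * w ^ k)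
      ((1 - w) ^ (-a)) := by
  have hw' : w ∈ Metric.eball (0 : ℂ) 1 := by
    simpa [edist_zero_right, ← ofReal_norm, ENNReal.ofReal_lt_one] using hw
  have h := (Complex.one_div_one_sub_cpow_hasFPowerSeriesOnBall_zero a).hasSum hw'
  simpa [FormalMultilinearSeries.ofScalars_apply_eq, choose_add_sub_one_eq, Complex.cpow_neg,
    mul_comm (w ^ _)] using h

theorem one_sub_mul_mem_slitPlane {z : ℂ} (hz : z ∈ gaussDomain) {t : ℝ} (h0 : 0 ≤ t) (h1 : t ≤ 1) :
    1 - z * t ∈ Complex.slitPlane := by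
  have h := Complex.starConvex_one_slitPlane hz (sub_nonneg.2 h1) h0 (by ring)
  convert h using 1
  simp only [Complex.real_smul]
  push_cast
  ring

/-- Expand `(1 - z t) ^ (-a)` binomially and integrate termwise; as `|t| ≤ 1`, the `k`-th term is
dominated by the beta integrand times `‖c k * z ^ k‖`. -/
theorem eulerIntegral_hasSum {a b z : ℂ} (ha : 0 < a.re) (hb : 0 < b.re) (hz : ‖z‖ < 1) :
    HasSum (fun k : ℕ => (ascPochhammer ℂ k).eval a / (k.factorial : ℂ) * z ^ k *
      Complex.betaIntegral (b + k) a) (eulerIntegral a b z) := by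
  set c : ℕ → ℂ := fun k => (ascPochhammer ℂ k).eval a / (k.factorial : ℂ) with hc
  set g : ℝ → ℂ := fun t => (t : ℂ) ^ (b - 1) * (1 - (t : ℂ)) ^ (a - 1) with hg
  have hgi : IntervalIntegrable g volume 0 1 := Complex.betaIntegral_convergent hb ha
  have hcs := (binomial_summableOnDisc a).summable_norm hz
  have key := intervalIntegral.hasSum_integral_of_dominated_convergence
    (μ := volume) (a := 0) (b := 1)
    (F := fun (k : ℕ) (t : ℝ) => g t * (c k * (z * t) ^ k))
    (f := fun t : ℝ => g t * (1 - z * t) ^ (-a))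
    (fun k t => ‖g t‖ * ‖c k * z ^ k‖) ?_ ?_ ?_ ?_ ?_
  · refine key.congr_fun fun k => ?_
    rw [Complex.betaIntegral, ← intervalIntegral.integral_const_mul]
    refine intervalIntegral.integral_congr_ae (ae_of_all _ fun t ht => ?_)
    rw [uIoc_of_le zero_le_one] at ht
    have ht0 : (t : ℂ) ≠ 0 := by exact_mod_cast ht.1.ne'
    simp only [hg, mul_pow]
    rw [show b + (k : ℂ) - 1 = (b - 1) + k by ring, Complex.cpow_add _ _ ht0, Complex.cpow_natCast]
    ring
  · intro k
    refine hgi.def'.aestronglyMeasurable.mul ?_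
    exact Continuous.aestronglyMeasurable (by fun_prop)
  · refine fun k => ae_of_all _ fun t ht => ?_
    rw [uIoc_of_le zero_le_one] at ht
    rw [norm_mul, mul_pow, ← mul_assoc, norm_mul (c k * z ^ k)]
    refine mul_le_mul_of_nonneg_left ?_ (norm_nonneg _)
    refine mul_le_of_le_one_right (norm_nonneg _) ?_
    rw [norm_pow, Complex.norm_real, Real.norm_of_nonneg ht.1.le]
    exact pow_le_one₀ ht.1.le ht.2
  · exact ae_of_all _ fun t _ => hcs.mul_left _
  · simp only [tsum_mul_left]
    exact hgi.norm.mul_const _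
  · refine ae_of_all _ fun t ht => ?_
    rw [uIoc_of_le zero_le_one] at ht
    refine (hasSum_one_sub_cpow_neg a ?_).mul_left _
    rw [norm_mul, Complex.norm_real, Real.norm_of_nonneg ht.1.le]
    exact (mul_le_of_le_one_right (norm_nonneg _) ht.2).trans_lt hz

theorem betaIntegral_add_natCast {a b : ℂ} (ha : 0 < a.re) (hb : 0 < b.re) (k : ℕ) :
    Complex.betaIntegral (b + k) a =
      Complex.Gamma a * Complex.Gamma b / Complex.Gamma (a + b) *
        ((ascPochhammer ℂ k).eval b / (ascPochhammer ℂ k).eval (a + b)) := by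
  have hab : 0 < (a + b).re := by simpa using add_pos ha hb
  have hbk : 0 < (b + k).re := by simpa using add_pos_of_pos_of_nonneg hb k.cast_nonneg
  have habk : 0 < (a + b + k).re := by simpa using add_pos_of_pos_of_nonneg hab k.cast_nonneg
  have h := Complex.Gamma_mul_Gamma_eq_betaIntegral hbk ha
  have h1 := Complex.Gamma_ne_zero_of_re_pos hab
  have h2 := Complex.Gamma_ne_zero_of_re_pos hb
  have h3 := Complex.Gamma_ne_zero_of_re_pos habk
  have hne : ∀ {s : ℂ}, 0 < s.re → ∀ j : ℕ, s ≠ -j := fun hs j hj =>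
    ne_neg_natCast_of_re_pos hs j (by rw [hj, neg_neg])
  rw [← Complex.Gamma_add_nat_div_Gamma_eq b (hne hb),
    ← Complex.Gamma_add_nat_div_Gamma_eq (a + b) (hne hab)]
  rw [show b + k + a = a + b + k by ring] at h
  field_simp
  linear_combination -h

theorem eulerIntegral_eq_gauss {a b z : ℂ} (ha : 0 < a.re) (hb : 0 < b.re) (hz : ‖z‖ < 1) :
    eulerIntegral a b z =
      Complex.Gamma a * Complex.Gamma b / Complex.Gamma (a + b) * ₂F₁ a b (a + b) z := by
  have hab : 0 < (a + b).re := by simpa using add_pos ha hb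
  have h1 := eulerIntegral_hasSum ha hb hz
  have h2 := (((summableOnDisc_gaussCoeff ha hb hab).hasSum hz).mul_left
    (Complex.Gamma a * Complex.Gamma b / Complex.Gamma (a + b)))
  rw [gauss_eq_seriesSum]
  refine h1.unique (h2.congr_fun fun k => ?_)
  rw [betaIntegral_add_natCast ha hb, ordinaryHypergeometricCoefficient]
  ring

/-- The integrand is not symmetric in `a` and `b`, but the Gauss series is. -/
theorem eulerIntegral_symm {a b z : ℂ} (ha : 0 < a.re) (hb : 0 < b.re) (hz : ‖z‖ < 1) :
    eulerIntegral a b z = eulerIntegral b a z := by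
  rw [eulerIntegral_eq_gauss ha hb hz, eulerIntegral_eq_gauss hb ha hz, ordinaryHypergeometric,
    ordinaryHypergeometricSeries_symm, ← ordinaryHypergeometric, add_comm b a, mul_comm (Complex.Gamma a)]

theorem isOpen_gaussDomain : IsOpen gaussDomain :=
  Complex.isOpen_slitPlane.preimage (continuous_const.sub continuous_id)

theorem mem_gaussDomain_of_norm_lt_one {z : ℂ} (hz : ‖z‖ < 1) : z ∈ gaussDomain :=
  one_sub_mem_slitPlane_of_norm_lt_one hz

theorem continuousOn_kernel (a : ℂ) : ContinuousOn (fun p : ℂ × ℝ => (1 - p.1 * (p.2 : ℂ)) ^ a)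
    (gaussDomain ×ˢ Icc 0 1) := by
  refine ContinuousOn.cpow (by fun_prop) continuousOn_const ?_
  rintro ⟨z, t⟩ ⟨hz, ht⟩
  exact one_sub_mul_mem_slitPlane hz ht.1 ht.2

theorem continuousOn_kernel_right (a : ℂ) {z : ℂ} (hz : z ∈ gaussDomain) :
    ContinuousOn (fun t : ℝ => (1 - z * (t : ℂ)) ^ a) (Icc 0 1) :=
  (continuousOn_kernel a).comp (f := fun t : ℝ => (z, t)) (by fun_prop) fun _ ht => ⟨hz, ht⟩

theorem kernel_aestronglyMeasurable (a : ℂ) {z : ℂ} (hz : z ∈ gaussDomain) :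
    AEStronglyMeasurable (fun t : ℝ => (1 - z * (t : ℂ)) ^ a)
      (volume.restrict (Ι (0 : ℝ) 1)) :=
  ((continuousOn_kernel_right a hz).mono (by rw [uIoc_of_le zero_le_one]; exact Ioc_subset_Icc_self)
    ).aestronglyMeasurable measurableSet_uIoc

theorem intervalIntegrable_eulerIntegrand {a b z : ℂ} (ha : 0 < a.re) (hb : 0 < b.re)
    (hz : z ∈ gaussDomain) :
    IntervalIntegrable (fun t : ℝ =>
      (t : ℂ) ^ (b - 1) * (1 - (t : ℂ)) ^ (a - 1) * (1 - z * t) ^ (-a)) volume 0 1 := by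
  refine (Complex.betaIntegral_convergent hb ha).mul_continuousOn ?_
  rw [uIcc_of_le zero_le_one]
  exact continuousOn_kernel_right _ hz

/-- Differentiation under the integral sign: on a closed disc times `[0, 1]` the `z`-derivative of
the kernel is bounded by compactness, and the remaining factor is the integrable beta integrand. -/
theorem differentiableOn_eulerIntegral {a b : ℂ} (ha : 0 < a.re) (hb : 0 < b.re) :
    DifferentiableOn ℂ (eulerIntegral a b) gaussDomain := by
  intro z₀ hz₀
  set g : ℝ → ℂ := fun t => (t : ℂ) ^ (b - 1) * (1 - (t : ℂ)) ^ (a - 1) with hg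
  have hgi : IntervalIntegrable g volume 0 1 := Complex.betaIntegral_convergent hb ha
  obtain ⟨r, hr, hrs⟩ := Metric.nhds_basis_closedBall.mem_iff.1 (isOpen_gaussDomain.mem_nhds hz₀)
  have hc : ContinuousOn (fun p : ℂ × ℝ => -a * (1 - p.1 * (p.2 : ℂ)) ^ (-a - 1) * -(p.2 : ℂ))
      (Metric.closedBall z₀ r ×ˢ Icc 0 1) := by
    refine (continuousOn_const.mul ((continuousOn_kernel _).mono
      (prod_mono hrs subset_rfl))).mul ?_
    fun_prop
  obtain ⟨M, hM⟩ := ((isCompact_closedBall z₀ r).prod isCompact_Icc).exists_bound_of_continuousOn hc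
  have h := intervalIntegral.hasDerivAt_integral_of_dominated_loc_of_deriv_le
    (μ := volume) (a := 0) (b := 1)
    (F := fun z t => g t * (1 - z * t) ^ (-a))
    (F' := fun z t => g t * (-a * (1 - z * t) ^ (-a - 1) * -(t : ℂ)))
    (bound := fun t => ‖g t‖ * M) (x₀ := z₀)
    (Metric.closedBall_mem_nhds z₀ hr) ?_ ?_ ?_ ?_ (hgi.norm.mul_const M) ?_
  · exact h.2.differentiableAt.differentiableWithinAt
  · filter_upwards [isOpen_gaussDomain.mem_nhds hz₀] with z hz
    exact hgi.def'.aestronglyMeasurable.mul (kernel_aestronglyMeasurable _ hz)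
  · exact intervalIntegrable_eulerIntegrand ha hb hz₀
  · refine hgi.def'.aestronglyMeasurable.mul (((kernel_aestronglyMeasurable _ hz₀).const_mul _).mul ?_)
    exact Continuous.aestronglyMeasurable (by fun_prop)
  · refine ae_of_all _ fun t ht z hz => ?_
    rw [uIoc_of_le zero_le_one] at ht
    rw [norm_mul]
    exact mul_le_mul_of_nonneg_left (hM (z, t) ⟨hz, Ioc_subset_Icc_self ht⟩) (norm_nonneg _)
  · refine ae_of_all _ fun t ht z hz => ?_
    rw [uIoc_of_le zero_le_one] at ht
    refine HasDerivAt.const_mul _ ?_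
    refine HasDerivAt.cpow_const (f := fun z : ℂ => 1 - z * t) ?_
      (one_sub_mul_mem_slitPlane (hrs hz) ht.1.le ht.2)
    simpa using ((hasDerivAt_id z).mul_const (t : ℂ)).const_sub 1

theorem isGaussBranch_eulerIntegral {a b : ℂ} (ha : 0 < a.re) (hb : 0 < b.re) :
    IsGaussBranch a b (a + b) fun z =>
      Complex.Gamma (a + b) / (Complex.Gamma b * Complex.Gamma a) * eulerIntegral a b z := by
  have hab : 0 < (a + b).re := by simpa using add_pos ha hb
  refine ⟨(differentiableOn_eulerIntegral ha hb).const_mul _, fun z hz => ?_⟩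
  have h1 := Complex.Gamma_ne_zero_of_re_pos ha
  have h2 := Complex.Gamma_ne_zero_of_re_pos hb
  have h3 := Complex.Gamma_ne_zero_of_re_pos hab
  simp only
  rw [eulerIntegral_eq_gauss ha hb hz]
  field_simp

theorem IsGaussBranch.gaussF {a b c : ℂ} {F : ℂ → ℂ} (hF : IsGaussBranch a b c F) :
    IsGaussBranch a b c (gaussF a b c) := by
  have h : ∃ F : ℂ → ℂ, IsGaussBranch a b c F := ⟨F, hF⟩
  have heq : _root_.gaussF a b c = h.choose := by
    funext z
    rw [_root_.gaussF]
    split_ifs with hz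
    · exact (h.choose_spec.2 z hz).symm
    · rfl
  rw [heq]
  exact h.choose_spec

/-- Analytic functions on the cut plane that agree on the unit disc agree. -/
theorem IsGaussBranch.eqOn {a b c : ℂ} {F G : ℂ → ℂ} (hF : IsGaussBranch a b c F)
    (hG : IsGaussBranch a b c G) : EqOn F G gaussDomain := by
  have hpre : IsPreconnected gaussDomain := by
    -- The cut plane is star-shaped about `0`, hence connected.
    have h : StarConvex ℝ (0 : ℂ) gaussDomain := by
      intro z hz s t hs ht hst
      have := one_sub_mul_mem_slitPlane hz ht (by linarith)
      simpa [gaussDomain, mul_comm] using this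
    exact (h.isPathConnected (mem_gaussDomain_of_norm_lt_one (by simp))).isConnected.isPreconnected
  refine (hF.1.analyticOnNhd isOpen_gaussDomain).eqOn_of_preconnected_of_eventuallyEq
    (hG.1.analyticOnNhd isOpen_gaussDomain) hpre (z₀ := 0) (mem_gaussDomain_of_norm_lt_one (by simp)) ?_
  filter_upwards [Metric.ball_mem_nhds (0 : ℂ) one_pos] with z hz
  rw [mem_ball_zero_iff] at hz
  rw [hF.2 z hz, hG.2 z hz]

/-! ### Gauss' integral for the digamma function -/

/-- Near `0` the power `t ^ (b - 1)` is integrable because `Re b > 0`; near `1` the quotient is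
minus a difference quotient of a differentiable function, so the singularity is removable. -/
theorem intervalIntegrable_cpow_sub_one_div {b : ℂ} (hb : 0 < b.re) :
    IntervalIntegrable (fun t : ℝ => ((t : ℂ) ^ (b - 1) - 1) * (1 - (t : ℂ))⁻¹) volume 0 1 := by
  refine IntervalIntegrable.trans (b := 1 / 2) ?_ ?_
  · refine IntervalIntegrable.mul_continuousOn ?_ ?_
    · refine IntervalIntegrable.sub (intervalIntegral.intervalIntegrable_cpow' ?_)
        intervalIntegrable_const
      simpa using hb
    · rw [uIcc_of_le (by norm_num)]
      refine ContinuousOn.inv₀ (by fun_prop) fun t ht => ?_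
      have : (1 : ℝ) - t ≠ 0 := by have := ht.2; intro h; linarith
      exact_mod_cast this
  · set f : ℝ → ℂ := fun t => (t : ℂ) ^ (b - 1) with hf
    have hd : ∀ t : ℝ, 0 < t → DifferentiableAt ℝ f t := fun t ht => by
      have h : HasDerivAt (fun z : ℂ => z ^ (b - 1)) ((b - 1) * (t : ℂ) ^ (b - 1 - 1) * 1) (t : ℂ) :=
        (hasDerivAt_id _).cpow_const (Or.inl (by simpa using ht))
      exact h.comp_ofReal.differentiableAt
    have hc : ContinuousOn (fun t => -dslope f 1 t) (Icc (1 / 2) 1) := by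
      refine ContinuousOn.neg fun t ht => ?_
      have ht0 : 0 < t := by have := ht.1; linarith
      rcases eq_or_ne t 1 with rfl | h1
      · exact (continuousAt_dslope_same.2 (hd 1 one_pos)).continuousWithinAt
      · exact ((continuousAt_dslope_of_ne h1).2 (hd t ht0).continuousAt).continuousWithinAt
    rw [← uIcc_of_le (by norm_num : (1 / 2 : ℝ) ≤ 1)] at hc
    refine hc.intervalIntegrable.congr_ae ?_
    have hne : ∀ᵐ t : ℝ ∂volume.restrict (Ι (1 / 2) 1), t ≠ 1 :=
      ae_restrict_of_ae (Measure.ae_ne volume 1)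
    filter_upwards [hne] with t ht
    have h1 : (1 : ℂ) - t ≠ 0 := sub_ne_zero.2 (by exact_mod_cast ht.symm)
    have h2 : (t : ℂ) - 1 ≠ 0 := sub_ne_zero.2 (by exact_mod_cast ht)
    rw [dslope_of_ne _ ht, slope_def_module]
    simp only [hf, Complex.ofReal_one, Complex.one_cpow, Complex.real_smul, Complex.ofReal_inv,
      Complex.ofReal_sub]
    field_simp
    ring

/-- Gauss' integral for the digamma function. -/
theorem integral_cpow_sub_one_div {b : ℂ} (hb : 0 < b.re) :
    ∫ t in (0 : ℝ)..1, ((t : ℂ) ^ (b - 1) - 1) * (1 - (t : ℂ))⁻¹ =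
      Complex.digamma 1 - Complex.digamma b := by
  have h1re : 0 < (1 : ℂ).re := by simp
  -- Regularise `(1 - t)⁻¹` to `(1 - t) ^ (δ - 1)` with `δ → 0+`, so that the integral splits into
  -- two convergent beta integrals.
  have hlim : Tendsto (fun δ : ℝ => ∫ t in (0 : ℝ)..1,
      ((t : ℂ) ^ (b - 1) - 1) * (1 - (t : ℂ)) ^ ((δ : ℂ) - 1)) (𝓝[>] 0)
      (𝓝 (∫ t in (0 : ℝ)..1, ((t : ℂ) ^ (b - 1) - 1) * (1 - (t : ℂ))⁻¹)) := by
    refine intervalIntegral.tendsto_integral_filter_of_dominated_convergence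
      (fun t => ‖((t : ℂ) ^ (b - 1) - 1) * (1 - (t : ℂ))⁻¹‖) ?_ ?_
      (intervalIntegrable_cpow_sub_one_div hb).norm ?_
    · refine Eventually.of_forall fun δ => Measurable.aestronglyMeasurable ?_
      fun_prop
    · filter_upwards [self_mem_nhdsWithin] with δ hδ
      refine ae_of_all _ fun t ht => ?_
      rw [uIoc_of_le zero_le_one] at ht
      rcases ht.2.eq_or_lt with rfl | h1
      · simp
      have h1' : 0 < 1 - t := by linarith
      have hne : (1 : ℂ) - t ≠ 0 := by exact_mod_cast h1'.ne'
      rw [Complex.cpow_sub _ _ hne, Complex.cpow_one, div_eq_mul_inv, ← mul_assoc, mul_right_comm,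
        norm_mul]
      refine mul_le_of_le_one_right (norm_nonneg _) ?_
      rw [show (1 : ℂ) - t = ((1 - t : ℝ) : ℂ) by push_cast; ring,
        Complex.norm_cpow_eq_rpow_re_of_pos h1']
      exact Real.rpow_le_one h1'.le (by linarith [ht.1]) (le_of_lt hδ)
    · refine ae_of_all _ fun t ht => ?_
      rw [uIoc_of_le zero_le_one] at ht
      rcases ht.2.eq_or_lt with rfl | h1
      · simp
      have h1' : 0 < 1 - t := by linarith
      have hne : (1 : ℂ) - t ≠ 0 := by exact_mod_cast h1'.ne'
      refine Tendsto.const_mul _ ?_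
      have hc : Continuous fun δ : ℝ => (1 - (t : ℂ)) ^ ((δ : ℂ) - 1) :=
        Continuous.const_cpow (by fun_prop) (Or.inl hne)
      have := (hc.tendsto 0).mono_left (nhdsWithin_le_nhds (s := Ioi 0))
      simpa [Complex.cpow_neg_one] using this
  have hG : ∀ {s : ℂ}, 0 < s.re → HasDerivAt (fun δ : ℂ => (Complex.Gamma (s + δ))⁻¹ * Complex.Gamma s)
      (-Complex.digamma s) 0 := by
    intro s hs
    have hne := Complex.Gamma_ne_zero_of_re_pos hs
    have hd : HasDerivAt Complex.Gamma (deriv Complex.Gamma s) (s + 0) := by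
      rw [add_zero]
      exact (Complex.differentiableAt_Gamma s fun m hm =>
        ne_neg_natCast_of_re_pos hs m (by rw [hm, neg_neg])).hasDerivAt
    have := ((hd.comp_const_add s 0).inv (by simpa using hne)).mul_const (Complex.Gamma s)
    convert! this using 1
    rw [Complex.digamma_def, logDeriv_apply, add_zero]
    field_simp
  have hlim2 : Tendsto (fun δ : ℝ => ∫ t in (0 : ℝ)..1,
      ((t : ℂ) ^ (b - 1) - 1) * (1 - (t : ℂ)) ^ ((δ : ℂ) - 1)) (𝓝[>] 0)
      (𝓝 (Complex.digamma 1 - Complex.digamma b)) := by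
    have hsl := ((hG hb).sub (hG h1re)).tendsto_slope_zero
    have hofReal : Tendsto (fun δ : ℝ => (δ : ℂ)) (𝓝[>] 0) (𝓝[≠] 0) := by
      refine tendsto_nhdsWithin_iff.2 ⟨tendsto_ofReal_nhdsWithin_lens.mono_right
        nhdsWithin_le_nhds, ?_⟩
      filter_upwards [self_mem_nhdsWithin] with δ hδ
      exact Complex.ofReal_ne_zero.2 (ne_of_gt hδ)
    -- Both beta integrals carry the factor `Γ(δ) = Γ(δ + 1) / δ`; the `1 / δ` turns their
    -- difference into a difference quotient of `Γ(b)/Γ(b+δ) - Γ(1)/Γ(1+δ)`, which vanishes at `δ =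
    -- 0`.
    have hΓ : Tendsto (fun δ : ℝ => Complex.Gamma ((δ : ℂ) + 1)) (𝓝[>] 0) (𝓝 1) := by
      have hc : ContinuousAt (fun s : ℂ => Complex.Gamma (s + 1)) 0 := by
        refine ContinuousAt.comp (g := Complex.Gamma) ?_ (by fun_prop)
        refine (Complex.differentiableAt_Gamma _ fun m hm => ?_).continuousAt
        exact ne_neg_natCast_of_re_pos h1re m (by rw [← zero_add (1 : ℂ), hm, neg_neg])
      have := hc.tendsto.comp (hofReal.mono_right nhdsWithin_le_nhds)
      rwa [zero_add, Complex.Gamma_one] at this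
    have hprod := hΓ.mul (hsl.comp hofReal)
    rw [one_mul, show -Complex.digamma b - -Complex.digamma 1 =
      Complex.digamma 1 - Complex.digamma b by ring] at hprod
    refine hprod.congr' ?_
    filter_upwards [self_mem_nhdsWithin] with δ hδ
    have hδ0 : (0 : ℝ) < δ := hδ
    have hδre : 0 < (δ : ℂ).re := by simpa using hδ0
    have hδne : (δ : ℂ) ≠ 0 := Complex.ofReal_ne_zero.2 hδ0.ne'
    have e : ∫ t in (0 : ℝ)..1, ((t : ℂ) ^ (b - 1) - 1) * (1 - (t : ℂ)) ^ ((δ : ℂ) - 1) =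
        Complex.betaIntegral b δ - Complex.betaIntegral 1 δ := by
      rw [Complex.betaIntegral, Complex.betaIntegral, ← intervalIntegral.integral_sub
        (Complex.betaIntegral_convergent hb hδre) (Complex.betaIntegral_convergent h1re hδre)]
      refine intervalIntegral.integral_congr fun t _ => ?_
      simp only [sub_self, Complex.cpow_zero]
      ring
    have hβ : ∀ {s : ℂ}, 0 < s.re → Complex.betaIntegral s δ =
        (Complex.Gamma (s + δ))⁻¹ * Complex.Gamma s * Complex.Gamma δ := by
      intro s hs
      have hne : Complex.Gamma (s + δ) ≠ 0 :=
        Complex.Gamma_ne_zero_of_re_pos (by simpa using add_pos hs hδ0)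
      have := Complex.Gamma_mul_Gamma_eq_betaIntegral hs hδre
      field_simp
      linear_combination -this
    rw [e, hβ hb, hβ h1re, Complex.Gamma_add_one _ hδne]
    have hb' := Complex.Gamma_ne_zero_of_re_pos hb
    simp only [Function.comp, Pi.sub_apply, zero_add, add_zero, Complex.Gamma_one, smul_eq_mul,
      inv_one, mul_one, inv_mul_cancel₀ hb']
    field_simp
    ring
  exact tendsto_nhds_unique hlim hlim2

/-! ### The logarithmic singularity of Euler's integral -/

/-- The moduli contribute `(s / ‖v‖) ^ Re a ≤ 1` and the argument of `v` at most `exp (π |Im a|)`.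
With `s = 1 - t` and `v = 1 - (1 - x) t` this gives a bound independent of `x`. -/
theorem norm_cpow_mul_cpow_neg_le {a v : ℂ} (ha : 0 < a.re) {s : ℝ} (hs : 0 < s) (hv : s ≤ ‖v‖) :
    ‖(s : ℂ) ^ a * v ^ (-a)‖ ≤ Real.exp (Real.pi * |a.im|) := by
  have hv0 : 0 < ‖v‖ := hs.trans_le hv
  rw [norm_mul, Complex.norm_cpow_eq_rpow_re_of_pos hs,
    Complex.norm_cpow_of_ne_zero (norm_pos_iff.1 hv0), Complex.neg_re, Complex.neg_im,
    Real.rpow_neg hv0.le, div_eq_mul_inv, ← Real.exp_neg, ← mul_assoc, ← div_eq_mul_inv]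
  have h1 : s ^ a.re / ‖v‖ ^ a.re ≤ 1 :=
    div_le_one_of_le₀ (Real.rpow_le_rpow hs.le hv ha.le) (by positivity)
  have h2 : -(v.arg * -a.im) ≤ Real.pi * |a.im| := by
    rw [mul_neg, neg_neg]
    refine (le_abs_self _).trans ?_
    rw [abs_mul]
    exact mul_le_mul_of_nonneg_right (Complex.abs_arg_le_pi v) (abs_nonneg _)
  calc _ ≤ 1 * Real.exp (-(v.arg * -a.im)) := mul_le_mul_of_nonneg_right h1 (Real.exp_nonneg _)
    _ ≤ _ := by rw [one_mul]; exact Real.exp_le_exp.2 h2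

theorem one_sub_mem_gaussDomain {x : ℂ} (hx : x ∈ lens) : 1 - x ∈ gaussDomain := by
  rw [gaussDomain, mem_ofPred_eq, sub_sub_cancel]
  exact mem_slitPlane_of_mem_lens hx

/-- Subtracting the integral with `b = 1` cancels the singularity: the difference is the integrand
of Gauss' integral times `(1 - t) ^ a * (1 - (1 - x) t) ^ (-a)`, which is bounded and tends to `1`.
-/
theorem tendsto_eulerIntegral_sub {a b : ℂ} (ha : 0 < a.re) (hb : 0 < b.re) :
    Tendsto (fun x => eulerIntegral a b (1 - x) - eulerIntegral a 1 (1 - x)) (𝓝[lens] 0)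
      (𝓝 (Complex.digamma 1 - Complex.digamma b)) := by
  rw [← integral_cpow_sub_one_div hb]
  have h1re : 0 < (1 : ℂ).re := by simp
  have hx : ∀ᶠ x : ℂ in 𝓝[lens] 0, x ∈ lens := self_mem_nhdsWithin
  have hI : ∀ x ∈ lens, eulerIntegral a b (1 - x) - eulerIntegral a 1 (1 - x) =
      ∫ t in (0 : ℝ)..1, ((t : ℂ) ^ (b - 1) * (1 - (t : ℂ)) ^ (a - 1) * (1 - (1 - x) * t) ^ (-a) -
        (t : ℂ) ^ ((1 : ℂ) - 1) * (1 - (t : ℂ)) ^ (a - 1) * (1 - (1 - x) * t) ^ (-a)) :=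
    fun x hx => (intervalIntegral.integral_sub
      (intervalIntegrable_eulerIntegrand ha hb (one_sub_mem_gaussDomain hx))
      (intervalIntegrable_eulerIntegrand ha h1re (one_sub_mem_gaussDomain hx))).symm
  have hfactor : ∀ (x : ℂ) (t : ℝ), t < 1 →
      (t : ℂ) ^ (b - 1) * (1 - (t : ℂ)) ^ (a - 1) * (1 - (1 - x) * t) ^ (-a) -
        (t : ℂ) ^ ((1 : ℂ) - 1) * (1 - (t : ℂ)) ^ (a - 1) * (1 - (1 - x) * t) ^ (-a) =
      ((t : ℂ) ^ (b - 1) - 1) * (1 - (t : ℂ))⁻¹ *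
        (((1 - t : ℝ) : ℂ) ^ a * (1 - (1 - x) * t) ^ (-a)) := by
    intro x t ht
    have hne : (1 : ℂ) - t ≠ 0 := by
      have : (1 : ℝ) - t ≠ 0 := by linarith
      exact_mod_cast this
    rw [sub_self, Complex.cpow_zero, Complex.cpow_sub _ _ hne, Complex.cpow_one]
    push_cast
    field_simp
  refine Tendsto.congr' (hx.mono fun x hx => (hI x hx).symm) ?_
  refine intervalIntegral.tendsto_integral_filter_of_dominated_convergence
    (fun t => ‖((t : ℂ) ^ (b - 1) - 1) * (1 - (t : ℂ))⁻¹‖ * Real.exp (Real.pi * |a.im|)) ?_ ?_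
    ((intervalIntegrable_cpow_sub_one_div hb).norm.mul_const _) ?_
  · exact Eventually.of_forall fun x => Measurable.aestronglyMeasurable (by fun_prop)
  · filter_upwards [hx] with x hx
    refine ae_of_all _ fun t ht => ?_
    rw [uIoc_of_le zero_le_one] at ht
    rcases ht.2.eq_or_lt with rfl | h1
    · simp
    rw [hfactor x t h1, norm_mul]
    refine mul_le_mul_of_nonneg_left (norm_cpow_mul_cpow_neg_le ha (by linarith) ?_) (norm_nonneg _)
    -- `Re (1 - (1 - x) t) = 1 - t + t Re x ≥ 1 - t`, since `Re x > 0` on the lens.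
    refine le_trans ?_ (Complex.re_le_norm _)
    have : 0 ≤ x.re * t := mul_nonneg (re_pos_of_mem_lens hx).le ht.1.le
    simp
    linarith
  · refine ae_of_all _ fun t ht => ?_
    rw [uIoc_of_le zero_le_one] at ht
    rcases ht.2.eq_or_lt with rfl | h1
    · simpa using tendsto_const_nhds
    simp only [hfactor _ t h1]
    have h1' : 0 < 1 - t := by linarith
    have hne : ((1 - t : ℝ) : ℂ) ≠ 0 := by exact_mod_cast h1'.ne'
    have hc : ContinuousAt (fun x : ℂ => (1 - (1 - x) * t) ^ (-a)) 0 := by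
      refine ContinuousAt.cpow (by fun_prop) continuousAt_const (Or.inl ?_)
      simpa using h1
    have h := (hc.tendsto.mono_left (nhdsWithin_le_nhds (s := lens))).const_mul
      (((1 - t : ℝ) : ℂ) ^ a)
    have e : ((1 - t : ℝ) : ℂ) ^ a * (1 - (1 - 0) * (t : ℂ)) ^ (-a) = 1 := by
      rw [show (1 : ℂ) - (1 - 0) * t = ((1 - t : ℝ) : ℂ) by push_cast; ring, Complex.cpow_neg,
        mul_inv_cancel₀]
      exact (Complex.cpow_ne_zero_iff_of_exponent_ne_zero (fun h => by simp [h] at ha)).2 hne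
    rw [e] at h
    simpa using h.const_mul (((t : ℂ) ^ (b - 1) - 1) * (1 - (t : ℂ))⁻¹)

theorem eulerIntegral_one_one {z : ℂ} (hz : z ∈ gaussDomain) (hz0 : z ≠ 0) :
    eulerIntegral 1 1 z = -Complex.log (1 - z) / z := by
  have hd : ∀ t ∈ uIcc (0 : ℝ) 1, HasDerivAt (fun t : ℝ => -Complex.log (1 - z * t) / z)
      ((1 - z * (t : ℂ)) ^ (-1 : ℂ)) t := by
    intro t ht
    rw [uIcc_of_le zero_le_one] at ht
    have hs := one_sub_mul_mem_slitPlane hz ht.1 ht.2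
    have hne := Complex.slitPlane_ne_zero hs
    have h : HasDerivAt (fun w : ℂ => 1 - z * w) (-(z * 1)) (t : ℂ) :=
      ((hasDerivAt_id _).const_mul z).const_sub 1
    convert! ((h.clog hs).neg.div_const z).comp_ofReal using 1
    rw [Complex.cpow_neg_one]
    field_simp
  have h := intervalIntegral.integral_eq_sub_of_hasDerivAt hd
    (ContinuousOn.intervalIntegrable (by
      rw [uIcc_of_le zero_le_one]; exact continuousOn_kernel_right _ hz))
  rw [eulerIntegral]
  simp only [sub_self, Complex.cpow_zero, one_mul]
  rw [h]
  simp

theorem tendsto_mul_log_zero : Tendsto (fun x : ℂ => x * Complex.log x) (𝓝 0) (𝓝 0) := by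
  have h1 : Tendsto (fun x : ℂ => |‖x‖ * Real.log ‖x‖| + ‖x‖ * Real.pi) (𝓝 0) (𝓝 0) := by
    have hc : Continuous fun x : ℂ => |‖x‖ * Real.log ‖x‖| + ‖x‖ * Real.pi :=
      ((Real.continuous_mul_log.comp continuous_norm).abs).add (continuous_norm.mul continuous_const)
    simpa using hc.tendsto 0
  refine squeeze_zero_norm (fun x => ?_) h1
  rw [norm_mul, abs_mul, abs_norm, ← mul_add]
  refine mul_le_mul_of_nonneg_left ((Complex.norm_le_abs_re_add_abs_im _).trans ?_) (norm_nonneg _)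
  rw [Complex.log_re, Complex.log_im]
  gcongr
  exact Complex.abs_arg_le_pi x

/-- The logarithmic singularity of Euler's integral at `z = 1`. -/
theorem tendsto_eulerIntegral_add_log {a b : ℂ} (ha : 0 < a.re) (hb : 0 < b.re) :
    Tendsto (fun x => eulerIntegral a b (1 - x) + Complex.log x) (𝓝[lens] 0)
      (𝓝 (2 * Complex.digamma 1 - Complex.digamma a - Complex.digamma b)) := by
  have h1re : 0 < (1 : ℂ).re := by simp
  have hlog : Tendsto (fun x : ℂ => eulerIntegral 1 1 (1 - x) + Complex.log x) (𝓝[lens] 0)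
      (𝓝 0) := by
    have hden : Tendsto (fun x : ℂ => -(1 - x)⁻¹) (𝓝[lens] 0) (𝓝 (-(1 - 0)⁻¹)) := by
      have : ContinuousAt (fun x : ℂ => -(1 - x)⁻¹) 0 :=
        ((continuousAt_const.sub continuousAt_id).inv₀ (by simp)).neg
      exact this.tendsto.mono_left nhdsWithin_le_nhds
    have h := (tendsto_mul_log_zero.mono_left (nhdsWithin_le_nhds (s := lens))).mul hden
    rw [zero_mul] at h
    refine h.congr' ?_
    filter_upwards [self_mem_nhdsWithin] with x hx
    have hne := Complex.slitPlane_ne_zero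
      (one_sub_mem_slitPlane_of_norm_lt_one (mem_lens.1 hx).1)
    rw [eulerIntegral_one_one (one_sub_mem_gaussDomain hx) hne, sub_sub_cancel]
    field_simp
    ring
  -- Go from `(a, b)` to `(a, 1)`, swap to `(1, a)` by symmetry, then go to `(1, 1)`, where the
  -- integral is an explicit logarithm.
  have h := ((tendsto_eulerIntegral_sub ha hb).add (tendsto_eulerIntegral_sub h1re ha)).add hlog
  rw [show Complex.digamma 1 - Complex.digamma b + (Complex.digamma 1 - Complex.digamma a) + 0 =
    2 * Complex.digamma 1 - Complex.digamma a - Complex.digamma b by ring] at h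
  refine h.congr' ?_
  filter_upwards [self_mem_nhdsWithin] with x hx
  rw [eulerIntegral_symm ha h1re (mem_lens.1 hx).2]
  ring

/-! ### The logarithmic solution -/

theorem digamma_natCast_succ_add {a : ℂ} (ha : 0 < a.re) (k : ℕ) :
    Complex.digamma (((k + 1 : ℕ) : ℂ) + a) = Complex.digamma (k + a) + (k + a)⁻¹ := by
  rw [← Complex.digamma_apply_add_one (k + a)]
  · push_cast
    ring_nf
  · intro m hm
    have hre : 0 < ((k : ℂ) + a).re := by simpa using add_pos_of_nonneg_of_pos k.cast_nonneg ha
    exact ne_neg_natCast_of_re_pos hre m (by rw [hm, neg_neg])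

/-- Each increment `1 / (k + a)` is at most `1 / Re a` in norm. Linear growth is crude but harmless
for convergence on the disc. -/
theorem norm_digamma_natCast_add_le {a : ℂ} (ha : 0 < a.re) (k : ℕ) :
    ‖Complex.digamma (k + a)‖ ≤ (‖Complex.digamma a‖ + a.re⁻¹) * (k + 1) := by
  have hC : 0 ≤ ‖Complex.digamma a‖ := norm_nonneg _
  have hinv : 0 < a.re⁻¹ := inv_pos.2 ha
  induction k with
  | zero => simp [hinv.le]
  | succ k ih =>
    have hle : ‖((k : ℂ) + a)⁻¹‖ ≤ a.re⁻¹ := by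
      rw [norm_inv]
      refine inv_anti₀ ha (le_trans ?_ (Complex.re_le_norm _))
      simp
    rw [digamma_natCast_succ_add ha]
    refine (norm_add_le _ _).trans ?_
    push_cast
    nlinarith

/-- The combination of digamma values in the logarithmic connection formula. -/
noncomputable def digammaCoeff (a b : ℂ) (k : ℕ) : ℂ :=
  2 * Complex.digamma (k + 1) - Complex.digamma (k + a) - Complex.digamma (k + b)

theorem exists_norm_digammaCoeff_le {a b : ℂ} (ha : 0 < a.re) (hb : 0 < b.re) :
    ∃ C : ℝ, ∀ k : ℕ, ‖digammaCoeff a b k‖ ≤ C * (k + 1) := by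
  have h1re : 0 < (1 : ℂ).re := by simp
  refine ⟨2 * (‖Complex.digamma 1‖ + (1 : ℂ).re⁻¹) + (‖Complex.digamma a‖ + a.re⁻¹) +
    (‖Complex.digamma b‖ + b.re⁻¹), fun k => ?_⟩
  have h1 := norm_digamma_natCast_add_le h1re k
  have h2 := norm_digamma_natCast_add_le ha k
  have h3 := norm_digamma_natCast_add_le hb k
  rw [digammaCoeff]
  refine (norm_sub_le _ _).trans ((add_le_add_left (norm_sub_le _ _) _).trans ?_)
  rw [norm_mul, Complex.norm_ofNat]
  linarith

/-- The coefficients of the regular part of the logarithmic solution at `c = 1`. -/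
noncomputable def logCoeff (a b : ℂ) (k : ℕ) : ℂ :=
  ordinaryHypergeometricCoefficient a b 1 k * digammaCoeff a b k

theorem logCoeff_eq (a b : ℂ) (k : ℕ) : logCoeff a b k =
    (ascPochhammer ℂ k).eval a * (ascPochhammer ℂ k).eval b / ((k.factorial : ℂ) ^ 2) *
      (2 * Complex.digamma ((k : ℂ) + 1) - Complex.digamma ((k : ℂ) + a)
        - Complex.digamma ((k : ℂ) + b)) := by
  rw [logCoeff, digammaCoeff, ordinaryHypergeometricCoefficient, ascPochhammer_eval_one]
  ring

theorem summableOnDisc_logCoeff {a b : ℂ} (ha : 0 < a.re) (hb : 0 < b.re) :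
    SummableOnDisc (logCoeff a b) := by
  obtain ⟨C, hC⟩ := exists_norm_digammaCoeff_le ha hb
  refine (((summableOnDisc_gaussCoeff ha hb (c := 1) (by simp)).add_one_mul).const_mul
    (C : ℂ)).of_norm_le fun k => ?_
  have hk : ‖((k : ℂ) + 1)‖ = (k : ℝ) + 1 := by
    rw [← Nat.cast_add_one, Complex.norm_natCast]; push_cast; ring
  rw [logCoeff, norm_mul, norm_mul (C : ℂ), norm_mul ((k : ℂ) + 1), hk, Complex.norm_real,
    ← mul_assoc, mul_comm]
  refine mul_le_mul_of_nonneg_right ((hC k).trans ?_) (norm_nonneg _)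
  exact mul_le_mul_of_nonneg_right (le_abs_self C) (by positivity)

/-- The right side is the `k`-th coefficient of `2 (1 - x) w' - (a + b) w`, which is what the
hypergeometric operator leaves of `w log x` when `w` is a solution. It arises from the increments `1
/ (k + 1)`, `1 / (k + a)`, `1 / (k + b)` of the digamma values. -/
theorem logCoeff_recurrence {a b : ℂ} (ha : 0 < a.re) (hb : 0 < b.re) (k : ℕ) :
    ((k : ℂ) + 1) * (k + 1) * logCoeff a b (k + 1) - (k + a) * (k + b) * logCoeff a b k =
      2 * derivCoeff (ordinaryHypergeometricCoefficient a b 1) k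
        - 2 * (k * ordinaryHypergeometricCoefficient a b 1 k)
        - (a + b) * ordinaryHypergeometricCoefficient a b 1 k := by
  have h1re : 0 < (1 : ℂ).re := by simp
  have hrec := gaussCoeff_succ (a := a) (b := b) h1re k
  have hne : ∀ {s : ℂ}, 0 < s.re → (k : ℂ) + s ≠ 0 := fun hs h =>
    ne_neg_natCast_of_re_pos hs k (eq_neg_of_add_eq_zero_left h)
  have h1 := hne h1re
  have h2 := hne ha
  have h3 := hne hb
  simp only [logCoeff, digammaCoeff, derivCoeff]
  rw [digamma_natCast_succ_add h1re, digamma_natCast_succ_add ha, digamma_natCast_succ_add hb]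
  set p := ordinaryHypergeometricCoefficient a b 1 k
  set q := ordinaryHypergeometricCoefficient a b 1 (k + 1)
  have hq : q = (k + a) * (k + b) * p / (((k : ℂ) + 1) * (k + 1)) := by
    rw [eq_div_iff (mul_ne_zero h1 h1)]
    linear_combination hrec
  rw [hq]
  field_simp
  ring

theorem gaussODE_regular {a b x : ℂ} (ha : 0 < a.re) (hb : 0 < b.re) (hx : ‖x‖ < 1) :
    GaussODE a b (seriesSum (ordinaryHypergeometricCoefficient a b 1))
      (seriesSum (derivCoeff (ordinaryHypergeometricCoefficient a b 1)))
      (seriesSum (derivCoeff (derivCoeff (ordinaryHypergeometricCoefficient a b 1)))) x := by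
  have h1re : 0 < (1 : ℂ).re := by simp
  have hs := summableOnDisc_gaussCoeff ha hb h1re
  refine ⟨hs.hasDerivAt hx, hs.derivCoeff.hasDerivAt hx, ?_⟩
  exact hs.hypergeometric_ode hx (e := fun _ => 0)
    (fun k => by rw [gaussCoeff_succ h1re, sub_self]) (by simp)

theorem GaussODE.add {a b x : ℂ} {w w₁ w₂ v v₁ v₂ : ℂ → ℂ} (hw : GaussODE a b w w₁ w₂ x)
    (hv : GaussODE a b v v₁ v₂ x) : GaussODE a b (w + v) (w₁ + v₁) (w₂ + v₂) x :=
  ⟨hw.hasDerivAt.add hv.hasDerivAt, hw.hasDerivAt_deriv.add hv.hasDerivAt_deriv, by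
    simp only [Pi.add_apply]; linear_combination hw.ode + hv.ode⟩

/-- The substitution `x ↦ 1 - x` turns parameter `c` into `a + b + 1 - c`, which is `1` for `c = a +
b`. -/
theorem gaussODE_reflected {a b x : ℂ} (K : ℂ) (ha : 0 < a.re) (hb : 0 < b.re) (hx : ‖1 - x‖ < 1) :
    GaussODE a b (fun x => K * seriesSum (ordinaryHypergeometricCoefficient a b (a + b)) (1 - x))
      (fun x => -K * seriesSum
        (derivCoeff (ordinaryHypergeometricCoefficient a b (a + b))) (1 - x))
      (fun x => K * seriesSum
        (derivCoeff (derivCoeff (ordinaryHypergeometricCoefficient a b (a + b)))) (1 - x)) x := by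
  have hab : 0 < (a + b).re := by simpa using add_pos ha hb
  have hs := summableOnDisc_gaussCoeff ha hb hab
  have hd : HasDerivAt (fun x : ℂ => 1 - x) (-1) x := (hasDerivAt_id x).const_sub 1
  refine ⟨?_, ?_, ?_⟩
  · convert! ((hs.hasDerivAt hx).comp x hd).const_mul K using 1
    ring
  · convert! ((hs.derivCoeff.hasDerivAt hx).comp x hd).const_mul (-K) using 1
    ring
  · have h := hs.hypergeometric_ode hx (e := fun _ => 0) (s := 0)
      (fun k => by rw [gaussCoeff_succ hab, sub_self]) (by simp)
    linear_combination K * h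

theorem gaussODE_logarithmic {a b x : ℂ} (ha : 0 < a.re) (hb : 0 < b.re) (hx : ‖x‖ < 1)
    (hxs : x ∈ Complex.slitPlane) :
    GaussODE a b
      (fun x => seriesSum (ordinaryHypergeometricCoefficient a b 1) x * Complex.log x
        - seriesSum (logCoeff a b) x)
      (fun x => seriesSum (derivCoeff (ordinaryHypergeometricCoefficient a b 1)) x * Complex.log x
        + seriesSum (ordinaryHypergeometricCoefficient a b 1) x * x⁻¹
        - seriesSum (derivCoeff (logCoeff a b)) x)
      (fun x => seriesSum (derivCoeff (derivCoeff (ordinaryHypergeometricCoefficient a b 1))) x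
          * Complex.log x
        + 2 * seriesSum (derivCoeff (ordinaryHypergeometricCoefficient a b 1)) x * x⁻¹
        - seriesSum (ordinaryHypergeometricCoefficient a b 1) x * (x ^ 2)⁻¹
        - seriesSum (derivCoeff (derivCoeff (logCoeff a b))) x) x := by
  have h1re : 0 < (1 : ℂ).re := by simp
  have hs := summableOnDisc_gaussCoeff ha hb h1re
  have hw := gaussODE_regular ha hb hx
  have hg := summableOnDisc_logCoeff ha hb
  have hx0 := Complex.slitPlane_ne_zero hxs
  have hl := Complex.hasDerivAt_log hxs
  refine ⟨?_, ?_, ?_⟩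
  · exact (hw.hasDerivAt.mul hl).sub (hg.hasDerivAt hx)
  · convert! ((hw.hasDerivAt_deriv.mul hl).add (hw.hasDerivAt.mul (hasDerivAt_inv hx0))).sub
      (hg.derivCoeff.hasDerivAt hx) using 1
    ring
  · have he := (((hs.derivCoeff.hasSum hx).mul_left 2).sub
      ((hs.hasSum_index_mul hx).mul_left 2)).sub ((hs.hasSum hx).mul_left (a + b))
    have h := hg.hypergeometric_ode hx (logCoeff_recurrence ha hb)
      (he.congr_fun fun k => by ring)
    have e := hw.ode
    field_simp
    linear_combination (x * Complex.log x) * e - x * h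

/-! ### The connection formula -/

theorem seriesSum_gaussCoeff_zero (a b c : ℂ) :
    seriesSum (ordinaryHypergeometricCoefficient a b c) 0 = 1 := by
  rw [← gauss_eq_seriesSum, ordinaryHypergeometric_zero]

theorem logCoeff_zero (a b : ℂ) : logCoeff a b 0 =
    2 * Complex.digamma 1 - Complex.digamma a - Complex.digamma b := by
  simp [logCoeff, digammaCoeff, ordinaryHypergeometricCoefficient]

theorem seriesSum_zero (a : ℕ → ℂ) : seriesSum a 0 = a 0 := by
  have h : ∀ k : ℕ, k ≠ 0 → a k * 0 ^ k = 0 := fun k hk => by simp [hk]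
  rw [seriesSum, tsum_eq_single 0 h, pow_zero, mul_one]

/-- Factor as `((w - 1) / x) * (x log x)`: the first factor tends to `w' 0`, the second to `0`. -/
theorem tendsto_gauss_sub_one_mul_log {a b : ℂ} (ha : 0 < a.re) (hb : 0 < b.re) :
    Tendsto (fun x => (seriesSum (ordinaryHypergeometricCoefficient a b 1) x - 1) * Complex.log x)
      (𝓝[≠] 0) (𝓝 0) := by
  have hd := (gaussODE_regular ha hb (x := 0) (by simp)).hasDerivAt
  have h := (hasDerivAt_iff_tendsto_slope_zero.1 hd).mul
    (tendsto_mul_log_zero.mono_left nhdsWithin_le_nhds)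
  rw [mul_zero] at h
  refine h.congr' ?_
  filter_upwards [self_mem_nhdsWithin] with x hx
  have hx0 : x ≠ 0 := hx
  rw [zero_add, seriesSum_gaussCoeff_zero, smul_eq_mul]
  field_simp

theorem eulerIntegral_eventuallyEq {a b : ℂ} (ha : 0 < a.re) (hb : 0 < b.re) :
    ∀ᶠ x in 𝓝[lens] 0, eulerIntegral a b (1 - x) =
      -(seriesSum (ordinaryHypergeometricCoefficient a b 1) x * Complex.log x)
        + seriesSum (logCoeff a b) x := by
  have h0 : ‖(0 : ℂ)‖ < 1 := by simp
  have hreg := gaussODE_regular ha hb h0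
  have hlens : ∀ᶠ x : ℂ in 𝓝[lens] 0, x ∈ lens := self_mem_nhdsWithin
  have hE : ∀ x ∈ lens, Complex.Gamma a * Complex.Gamma b / Complex.Gamma (a + b) *
      seriesSum (ordinaryHypergeometricCoefficient a b (a + b)) (1 - x) =
        eulerIntegral a b (1 - x) := fun x hx => by
    rw [eulerIntegral_eq_gauss ha hb (mem_lens.1 hx).2, gauss_eq_seriesSum]
  have hne : 𝓝[lens] (0 : ℂ) ≤ 𝓝[≠] 0 := nhdsWithin_mono _ fun x hx =>
    Complex.slitPlane_ne_zero (mem_slitPlane_of_mem_lens hx)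
  have key := gaussODE_eventually_eq_zero (a := a) (b := b)
    (fun x hx => gaussODE_regular ha hb (mem_lens.1 hx).1)
    (fun x hx => (gaussODE_reflected (Complex.Gamma a * Complex.Gamma b / Complex.Gamma (a + b))
      ha hb (mem_lens.1 hx).2).add
      (gaussODE_logarithmic ha hb (mem_lens.1 hx).1 (mem_slitPlane_of_mem_lens hx)))
    (by rw [seriesSum_gaussCoeff_zero]; exact one_ne_zero) hreg.hasDerivAt.continuousAt
    hreg.hasDerivAt_deriv.continuousAt ?_
  · filter_upwards [key, hlens] with x hx hxl
    simp only [Pi.add_apply] at hx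
    rw [hE x hxl] at hx
    linear_combination hx
  -- Split `E + w log x - g` as `(E + log x) + (w - 1) log x - g`; the limit of the first term is
  -- exactly `g 0`.
  · have h1 := tendsto_eulerIntegral_add_log ha hb
    have h2 := (tendsto_gauss_sub_one_mul_log ha hb).mono_left hne
    have h3 := ((summableOnDisc_logCoeff ha hb).hasDerivAt h0).continuousAt.tendsto.mono_left
      (nhdsWithin_le_nhds (s := lens))
    rw [seriesSum_zero, logCoeff_zero] at h3
    have h := (h1.add h2).sub h3
    rw [add_zero, sub_self] at h
    refine h.congr' ?_
    filter_upwards [hlens] with x hx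
    simp only [Pi.add_apply]
    rw [hE x hx]
    ring

theorem eulerIntegral_eq {a b x : ℂ} (ha : 0 < a.re) (hb : 0 < b.re) (hx : ‖x‖ < 1)
    (hxs : x ∈ Complex.slitPlane) : eulerIntegral a b (1 - x) =
      -(seriesSum (ordinaryHypergeometricCoefficient a b 1) x * Complex.log x)
        + seriesSum (logCoeff a b) x := by
  set Ω : Set ℂ := Metric.ball 0 1 ∩ Complex.slitPlane
  have hΩ : IsOpen Ω := Metric.isOpen_ball.inter Complex.isOpen_slitPlane
  have hhalf : (((1 / 2 : ℝ) : ℂ)) ∈ Metric.ball (0 : ℂ) 1 := by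
    rw [mem_ball_zero_iff, Complex.norm_real]; norm_num
  -- The slit disc is star-shaped about `1 / 2`; its natural centre `0` lies on the cut.
  have hpre : IsPreconnected Ω :=
    (StarConvex.isPathConnected (((convex_ball (0 : ℂ) 1).starConvex hhalf).inter
      (Complex.starConvex_ofReal_slitPlane (by norm_num)))
      ⟨hhalf, Or.inl (by norm_num)⟩).isConnected.isPreconnected
  have hL : DifferentiableOn ℂ (fun x => eulerIntegral a b (1 - x)) Ω :=
    (differentiableOn_eulerIntegral ha hb).comp (by fun_prop) fun y hy => by
      rw [gaussDomain, mem_ofPred_eq, sub_sub_cancel]; exact hy.2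
  have hR : DifferentiableOn ℂ (fun x =>
      -(seriesSum (ordinaryHypergeometricCoefficient a b 1) x * Complex.log x)
        + seriesSum (logCoeff a b) x) Ω := by
    intro y hy
    have hy1 := mem_ball_zero_iff.1 hy.1
    exact ((((gaussODE_regular ha hb hy1).hasDerivAt.mul (Complex.hasDerivAt_log hy.2)).neg).add
      ((summableOnDisc_logCoeff ha hb).hasDerivAt hy1)).differentiableAt.differentiableWithinAt
  have hev := eulerIntegral_eventuallyEq ha hb
  have := neBot_nhdsWithin_lens
  -- Equality is known only near the boundary point `0` of the lens; the identity theorem needs an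
  -- interior point `y` with equality on a full neighbourhood.
  obtain ⟨y, hy, hyl⟩ :=
    ((eventually_eventually_nhdsWithin.2 hev).and self_mem_nhdsWithin).exists
  rw [isOpen_lens.nhdsWithin_eq hyl] at hy
  exact (hL.analyticOnNhd hΩ).eqOn_of_preconnected_of_eventuallyEq (hR.analyticOnNhd hΩ) hpre
    (z₀ := y) ⟨mem_ball_zero_iff.2 (mem_lens.1 hyl).1, mem_slitPlane_of_mem_lens hyl⟩ hy
    ⟨mem_ball_zero_iff.2 hx, hxs⟩

end

theorem mainTheorem8 (μ ρ : ℂ) (hμ : 0 < μ.re) (hρ : 0 < ρ.re)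
    (hρ_nonint : ∀ n : ℕ, 0 < n → ρ ≠ (n : ℂ)) :
    IsGaussBranch μ ρ (μ + ρ) (gaussF μ ρ (μ + ρ)) ∧
    ∀ z : ℂ, ‖1 - z‖ < 1 → z ≠ 1 → |Complex.arg (1 - z)| < Real.pi →
      Summable (fun k : ℕ =>
        (ascPochhammer ℂ k).eval μ * (ascPochhammer ℂ k).eval ρ / ((k.factorial : ℂ) ^ 2) *
          (2 * Complex.digamma ((k : ℂ) + 1) - Complex.digamma ((k : ℂ) + μ)
            - Complex.digamma ((k : ℂ) + ρ)) * (1 - z) ^ k) ∧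
      gaussF μ ρ (μ + ρ) z =
        -(Complex.Gamma (μ + ρ) / (Complex.Gamma ρ * Complex.Gamma μ))
            * gaussF μ ρ 1 (1 - z) * Complex.log (1 - z)
        + Complex.Gamma (μ + ρ) / (Complex.Gamma ρ * Complex.Gamma μ) *
          ∑' k : ℕ,
            (ascPochhammer ℂ k).eval μ * (ascPochhammer ℂ k).eval ρ / ((k.factorial : ℂ) ^ 2) *
              (2 * Complex.digamma ((k : ℂ) + 1) - Complex.digamma ((k : ℂ) + μ)
                - Complex.digamma ((k : ℂ) + ρ)) * (1 - z) ^ k := by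
  have hbranch := isGaussBranch_eulerIntegral hμ hρ
  refine ⟨hbranch.gaussF, fun z hz hz1 harg => ?_⟩
  have hslit : 1 - z ∈ Complex.slitPlane := by
    rw [Complex.mem_slitPlane_iff_arg]
    exact ⟨fun h => by rw [h, abs_of_pos Real.pi_pos] at harg; exact lt_irrefl _ harg,
      sub_ne_zero.2 hz1.symm⟩
  simp only [← logCoeff_eq]
  refine ⟨((summableOnDisc_logCoeff hμ hρ).summable_norm hz).of_norm, ?_⟩
  have h := eulerIntegral_eq hμ hρ hz hslit
  rw [sub_sub_cancel] at h
  -- At `z`, possibly outside the unit disc, `gaussF` is replaced by Euler's integral through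
  -- uniqueness of the branch; at `1 - z` it is the series itself.
  rw [hbranch.gaussF.eqOn hbranch hslit, gaussF, if_pos hz, gauss_eq_seriesSum]
  simp only [h, seriesSum]
  ring
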